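/- Let $K$ be a field and let $(V,\triangleright,[\cdot,\cdot])$ be a post-Lie algebra over $K$: $\mathfrak g=(V,[\cdot,\cdot])$ is a Lie algebra and $\triangleright$ is a bilinear product on $V$ with $$[x,y]\triangleright z = x\triangleright(y\triangleright z)-(x\triangleright y)\triangleright z-y\triangleright(x\triangleright z)+(y\triangleright x)\triangleright z,\qquad x\triangleright[y,z]=[x\triangleright y,z]+[y,x\triangleright z].$$ Suppose that $V=\bigoplus_{\gamma\in\Gamma}V_\gamma$ is graded, with $V_0=0$, all $V_\gamma$ finite-dimensional, $[V_i,V_j]\subseteq V_{i+j}$ and $V_i\triangleright V_j\subseteq V_{i+j}$. Here $\Gamma=\mathbb N$, or more generally $\Gamma$ is a commutative cancellative monoid on which divisibility ($a\le b$ iff $b=a+c$ for some $c$) is a partial order with finitely many elements below any given one (such as $\mathbb N^{(C)}$ for a set $C$). Let $\Delta_{\sqcup\!\sqcup}(A)=A_{(1)}\otimes A_{(2)}$ be the unshuffle coproduct of $\mathcal U(\mathfrak g)$ (the algebra morphism for which the elements of $\mathfrak g$ are primitive), let $\triangleright$ also denote the Guin--Oudom extension of the post-Lie product to $\mathcal U(\mathfrak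 g)$, determined by $$1\triangleright A=A,\qquad xA\triangleright y=x\triangleright(A\triangleright y)-(x\triangleright A)\triangleright y,\qquad A\triangleright BC=(A_{(1)}\triangleright B)(A_{(2)}\triangleright C)$$ for $x,y\in\mathfrak g$ and $A,B,C\in\mathcal U(\mathfrak g)$, and put $A\ast B=A_{(1)}\cdot(A_{(2)}\triangleright B)$. Give $\mathcal U(\mathfrak g)$ the induced grading, and let $\mathcal U(\mathfrak g)^*=\bigoplus_\gamma(\mathcal U(\mathfrak g)_\gamma)^*$ be its graded dual. On $\mathcal U(\mathfrak g)^*$ let $\mathbin{\sqcup\!\sqcup}$ be the product dual to $\Delta_{\sqcup\!\sqcup}$, and let $\Delta_\odot$, $\Delta_\ast$ and $\rho_\triangleright$ be the maps $\mathcal U(\mathfrak g)^*\to\mathcal U(\mathfrak g)^*\otimes\mathcal U(\mathfrak g)^*$ dual to the products $\cdot$, $\ast$ and $\triangleright$: $$\langle A\otimes B,\Delta_\odot(f)\rangle=\langle AB,f\rangle,\quad \langle A\otimes B,\Delta_\ast(f)\rangle=\langle A\ast B,f\rangle,\quad \langle A\otimes B,\rho_\triangleright(f)\rangle=\langle A\triangleright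 B,f\rangle .$$ Let $m^{1,2}_{\sqcup\!\sqcup}(a\otimes b\otimes c\otimes d)=(a\mathbin{\sqcup\!\sqcup} b)\otimes c\otimes d$. Then $$(\mathrm{id}\otimes\rho_\triangleright)\rho_\triangleright=m^{1,2}_{\sqcup\!\sqcup}(\mathrm{id}\otimes\rho_\triangleright\otimes\mathrm{id})(\Delta_\odot\otimes\mathrm{id})\rho_\triangleright=(\Delta_\ast\otimes\mathrm{id})\rho_\triangleright .$$ -/

import Mathlib

open scoped TensorProduct

/-- A post-Lie algebra over a field `K`: a Lie algebra `V` with a bilinear product `graft`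
subject to the two post-Lie identities. -/
class PostLieAlgebra (K V : Type*) [Field K] [LieRing V] [LieAlgebra K V] where
  graft : V →ₗ[K] V →ₗ[K] V
  lie_graft : ∀ x y z : V, graft ⁅x, y⁆ z =
    graft x (graft y z) - graft (graft x y) z - graft y (graft x z) + graft (graft y x) z
  graft_lie : ∀ x y z : V, graft x ⁅y, z⁆ = ⁅graft x y, z⁆ + ⁅y, graft x z⁆

namespace PostLie

section Env

/-- The canonical linear map from a Lie algebra to its enveloping algebra. -/
noncomputable def inc (K L : Type*) [Field K] [LieRing L] [LieAlgebra K L] :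
    L →ₗ[K] UniversalEnvelopingAlgebra K L :=
  letI := LieRing.ofAssociativeRing (A := UniversalEnvelopingAlgebra K L)
  (UniversalEnvelopingAlgebra.ι K : L →ₗ⁅K⁆ UniversalEnvelopingAlgebra K L).toLinearMap

variable (K : Type*) {L : Type*} [Field K] [LieRing L] [LieAlgebra K L]

theorem inc_lie (x y : L) : inc K L ⁅x, y⁆ = inc K L x * inc K L y - inc K L y * inc K L x := by
  let := LieRing.ofAssociativeRing (A := UniversalEnvelopingAlgebra K L)
  exact LieHom.map_lie (UniversalEnvelopingAlgebra.ι K) x y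

/-- The algebra morphism out of the enveloping algebra that extends a linear map sending
brackets to commutators. -/
noncomputable def envLift {A : Type*} [Ring A] [Algebra K A] (f : L →ₗ[K] A)
    (hf : ∀ x y, f ⁅x, y⁆ = f x * f y - f y * f x) : UniversalEnvelopingAlgebra K L →ₐ[K] A :=
  letI := LieRing.ofAssociativeRing (A := A)
  UniversalEnvelopingAlgebra.lift K
    ({ f with map_lie' := fun {x y} => hf x y } : L →ₗ⁅K⁆ A)

theorem envLift_inc {A : Type*} [Ring A] [Algebra K A] (f : L →ₗ[K] A)
    (hf : ∀ x y, f ⁅x, y⁆ = f x * f y - f y * f x) (x : L) :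
    envLift K f hf (inc K L x) = f x := by
  let := LieRing.ofAssociativeRing (A := A)
  exact UniversalEnvelopingAlgebra.lift_ι_apply K _ x

theorem env_hom_ext {A : Type*} [Ring A] [Algebra K A]
    {f g : UniversalEnvelopingAlgebra K L →ₐ[K] A}
    (h : ∀ x, f (inc K L x) = g (inc K L x)) : f = g := by
  let := LieRing.ofAssociativeRing (A := A)
  apply UniversalEnvelopingAlgebra.hom_ext
  exact LieHom.ext h

theorem env_induction (S : Submodule K (UniversalEnvelopingAlgebra K L)) (h1 : 1 ∈ S)
    (hm : ∀ x A, A ∈ S → inc K L x * A ∈ S) (A) : A ∈ S := by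
  have key : Algebra.adjoin K (Set.range (inc K L)) = ⊤ := by
    let T := Algebra.adjoin K (Set.range (inc K L))
    let f : UniversalEnvelopingAlgebra K L →ₐ[K] T :=
      envLift K (LinearMap.codRestrict (Subalgebra.toSubmodule T) (inc K L)
        (fun x => Algebra.subset_adjoin ⟨x, rfl⟩)) (by
          intro x y; apply Subtype.ext; exact inc_lie K x y)
    have hf : T.val.comp f = AlgHom.id K _ := by
      apply env_hom_ext
      intro x
      change ((f (inc K L x) : T) : UniversalEnvelopingAlgebra K L) = _
      rw [envLift_inc]; rfl
    rw [eq_top_iff]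
    intro a _
    have := DFunLike.congr_fun hf a
    rw [← (show ((f a : T) : UniversalEnvelopingAlgebra K L) = a from this)]
    exact (f a).2
  have hA : A ∈ Subalgebra.toSubmodule (Algebra.adjoin K (Set.range (inc K L))) := by
    rw [key]; trivial
  rw [Algebra.adjoin_eq_span] at hA
  refine Submodule.span_le.2 ?_ hA
  intro a ha
  induction ha using Submonoid.closure_induction_left with
  | one => exact h1
  | mul_left x hx y _ ih => obtain ⟨x, rfl⟩ := hx; exact hm x y ih

/-- The unshuffle coproduct: the algebra morphism `U(𝔤) → U(𝔤) ⊗ U(𝔤)` for which the elements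
of `𝔤` are primitive. -/
noncomputable def unshuffle (L : Type*) [LieRing L] [LieAlgebra K L] :
    UniversalEnvelopingAlgebra K L →ₐ[K]
      UniversalEnvelopingAlgebra K L ⊗[K] UniversalEnvelopingAlgebra K L :=
  envLift K
    ((Algebra.TensorProduct.includeLeft (R := K) (S := K)
        (A := UniversalEnvelopingAlgebra K L) (B := UniversalEnvelopingAlgebra K L)).toLinearMap ∘ₗ
        inc K L +
      (Algebra.TensorProduct.includeRight (R := K)
        (A := UniversalEnvelopingAlgebra K L) (B := UniversalEnvelopingAlgebra K L)).toLinearMap ∘ₗ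
        inc K L) (by
    intro x y
    simp only [LinearMap.add_apply, LinearMap.comp_apply, AlgHom.toLinearMap_apply,
      Algebra.TensorProduct.includeLeft_apply, Algebra.TensorProduct.includeRight_apply,
      inc_lie, mul_add, add_mul, Algebra.TensorProduct.tmul_mul_tmul, one_mul, mul_one,
      TensorProduct.sub_tmul, TensorProduct.tmul_sub]
    abel)

theorem unshuffle_inc (x : L) : unshuffle K L (inc K L x) = inc K L x ⊗ₜ 1 + 1 ⊗ₜ inc K L x :=
  envLift_inc K _ _ x

/-- The algebra morphism `A ↦ A + ε D(A)`, where `D` is the derivation of `U(𝔤)` that extends a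
given derivation of the Lie algebra `𝔤`. -/
noncomputable def derivAlg (D : L →ₗ[K] L) (hD : ∀ x y, D ⁅x, y⁆ = ⁅D x, y⁆ + ⁅x, D y⁆) :
    UniversalEnvelopingAlgebra K L →ₐ[K]
      TrivSqZeroExt (UniversalEnvelopingAlgebra K L) (UniversalEnvelopingAlgebra K L) :=
  envLift K
    ((TrivSqZeroExt.inlAlgHom K (UniversalEnvelopingAlgebra K L)
        (UniversalEnvelopingAlgebra K L)).toLinearMap ∘ₗ inc K L +
      (TrivSqZeroExt.inrHom (UniversalEnvelopingAlgebra K L)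
        (UniversalEnvelopingAlgebra K L)).restrictScalars K ∘ₗ inc K L ∘ₗ D) (by
    intro x y
    ext
    · simp [inc_lie]
    · simp [inc_lie, hD]; abel)

theorem derivAlg_fst (D : L →ₗ[K] L) (hD : ∀ x y, D ⁅x, y⁆ = ⁅D x, y⁆ + ⁅x, D y⁆) (A) :
    (derivAlg K D hD A).fst = A := by
  have : (TrivSqZeroExt.fstHom K (UniversalEnvelopingAlgebra K L)
      (UniversalEnvelopingAlgebra K L)).comp (derivAlg K D hD) = AlgHom.id K _ := by
    apply env_hom_ext
    intro x
    simp [derivAlg, envLift_inc]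
  exact DFunLike.congr_fun this A

end Env

section Second

variable (K V : Type*) [Field K] [LieRing V] [LieAlgebra K V] [PostLieAlgebra K V]

local notation "gr" => PostLieAlgebra.graft (K := K) (V := V)

/-- A copy of the vector space `V`, to carry the second Lie bracket `x ▷ y - y ▷ x + [x, y]`. -/
structure Second (K V : Type*) where
  val : V

/-- The bijection between `V` and its copy. -/
def Second.equiv : Second K V ≃ V := ⟨Second.val, Second.mk, fun _ => rfl, fun _ => rfl⟩

instance : AddCommGroup (Second K V) := (Second.equiv K V).addCommGroup
instance : Module K (Second K V) := (Second.equiv K V).module K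

/-- The underlying linear equivalence. -/
def toSecond : V ≃ₗ[K] Second K V := ((Second.equiv K V).linearEquiv K).symm

instance : Bracket (Second K V) (Second K V) where
  bracket x y := ⟨gr x.val y.val - gr y.val x.val + ⁅x.val, y.val⁆⟩

instance : LieRing (Second K V) where
  add_lie := by
    rintro ⟨x⟩ ⟨y⟩ ⟨z⟩
    apply congrArg Second.mk
    change gr (x + y) z - gr z (x + y) + ⁅x + y, z⁆
      = (gr x z - gr z x + ⁅x, z⁆) + (gr y z - gr z y + ⁅y, z⁆)
    simp only [map_add, LinearMap.add_apply, add_lie]; abel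
  lie_add := by
    rintro ⟨x⟩ ⟨y⟩ ⟨z⟩
    apply congrArg Second.mk
    change gr x (y + z) - gr (y + z) x + ⁅x, y + z⁆
      = (gr x y - gr y x + ⁅x, y⁆) + (gr x z - gr z x + ⁅x, z⁆)
    simp only [map_add, LinearMap.add_apply, lie_add]; abel
  lie_self := by
    rintro ⟨x⟩
    apply congrArg Second.mk
    change gr x x - gr x x + ⁅x, x⁆ = 0
    simp
  leibniz_lie := by
    rintro ⟨x⟩ ⟨y⟩ ⟨z⟩
    apply congrArg Second.mk
    change gr x (gr y z - gr z y + ⁅y, z⁆) - gr (gr y z - gr z y + ⁅y, z⁆) x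
        + ⁅x, gr y z - gr z y + ⁅y, z⁆⁆
      = (gr (gr x y - gr y x + ⁅x, y⁆) z - gr z (gr x y - gr y x + ⁅x, y⁆)
        + ⁅gr x y - gr y x + ⁅x, y⁆, z⁆)
      + (gr y (gr x z - gr z x + ⁅x, z⁆) - gr (gr x z - gr z x + ⁅x, z⁆) y
        + ⁅y, gr x z - gr z x + ⁅x, z⁆⁆)
    simp only [map_add, map_sub, LinearMap.add_apply, LinearMap.sub_apply, lie_add, lie_sub,
      add_lie, sub_lie, PostLieAlgebra.lie_graft, PostLieAlgebra.graft_lie, leibniz_lie x y z]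
    rw [← lie_skew y (gr z x)]
    abel

instance : LieAlgebra K (Second K V) where
  lie_smul := by
    rintro t ⟨x⟩ ⟨y⟩
    apply congrArg Second.mk
    change gr x (t • y) - gr (t • y) x + ⁅x, t • y⁆ = t • (gr x y - gr y x + ⁅x, y⁆)
    simp only [map_smul, LinearMap.smul_apply, lie_smul, smul_add, smul_sub]

theorem toSecond_lie (x y : V) :
    ⁅toSecond K V x, toSecond K V y⁆ = toSecond K V (gr x y - gr y x + ⁅x, y⁆) := rfl

/-- The canonical linear map from `V` to the enveloping algebra of the second Lie algebra. -/
noncomputable def inc₂ : V →ₗ[K] UniversalEnvelopingAlgebra K (Second K V) :=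
  inc K (Second K V) ∘ₗ (toSecond K V).toLinearMap

variable {V}

theorem inc₂_comm (x y : V) : inc₂ K V x * inc₂ K V y - inc₂ K V y * inc₂ K V x =
    inc₂ K V (gr x y - gr y x + ⁅x, y⁆) := by
  have := inc_lie K (toSecond K V x) (toSecond K V y)
  rw [toSecond_lie] at this
  exact this.symm

/-- Algebra morphisms out of the enveloping algebra of the second Lie algebra. -/
noncomputable def envLift₂ {A : Type*} [Ring A] [Algebra K A] (f : V →ₗ[K] A)
    (hf : ∀ x y, f (gr x y - gr y x + ⁅x, y⁆) = f x * f y - f y * f x) :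
    UniversalEnvelopingAlgebra K (Second K V) →ₐ[K] A :=
  envLift K (f ∘ₗ (toSecond K V).symm.toLinearMap) (fun x y => hf x.val y.val)

theorem envLift₂_inc {A : Type*} [Ring A] [Algebra K A] (f : V →ₗ[K] A)
    (hf : ∀ x y, f (gr x y - gr y x + ⁅x, y⁆) = f x * f y - f y * f x) (x : V) :
    envLift₂ K f hf (inc₂ K V x) = f x := envLift_inc K _ _ _

theorem env_induction₂ (S : Submodule K (UniversalEnvelopingAlgebra K (Second K V))) (h1 : 1 ∈ S)
    (hm : ∀ x A, A ∈ S → inc₂ K V x * A ∈ S) (A) : A ∈ S :=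
  env_induction K S h1 (fun x A hA => hm x.val A hA) A

end Second

section GuinOudom

variable (K V : Type*) [Field K] [LieRing V] [LieAlgebra K V] [PostLieAlgebra K V]

local notation "gr" => PostLieAlgebra.graft (K := K) (V := V)
local notation "U" => UniversalEnvelopingAlgebra K V
local notation "U₂" => UniversalEnvelopingAlgebra K (Second K V)
local notation "ι" => inc K V
local notation "ι₂" => inc₂ K V

/-- The derivation of `U(𝔤)` that extends `x ▷ -`, for a fixed `x`. -/
noncomputable def derAux (x : V) : U →ₗ[K] U :=
  TrivSqZeroExt.sndHom U U |>.restrictScalars K |>.comp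
    (derivAlg K (gr x) (PostLieAlgebra.graft_lie x)).toLinearMap

variable {V}

theorem derAux_inc (x y : V) : derAux K V x (ι y) = ι (gr x y) := by
  simp [derAux, derivAlg, envLift_inc]

theorem derAux_one (x : V) : derAux K V x 1 = 0 := by
  simp [derAux]

theorem derAux_mul (x : V) (A B : U) :
    derAux K V x (A * B) = derAux K V x A * B + A * derAux K V x B := by
  simp [derAux, derivAlg_fst]
  abel

variable (V)

/-- `der x` is the derivation of `U(𝔤)` that extends `x ▷ -`, linear in `x`. -/
noncomputable def der : V →ₗ[K] Module.End K U where
  toFun := derAux K V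
  map_add' x y := by
    ext A
    refine env_induction K (LinearMap.eqLocus (derAux K V (x + y)) (derAux K V x + derAux K V y))
      ?_ ?_ A
    · simp [derAux_one]
    · intro z B hB
      rw [LinearMap.mem_eqLocus] at *
      simp only [LinearMap.add_apply, derAux_mul, derAux_inc, hB, map_add, add_mul, mul_add]
      abel
  map_smul' t x := by
    ext A
    refine env_induction K (LinearMap.eqLocus (derAux K V (t • x)) (t • derAux K V x))
      ?_ ?_ A
    · simp [derAux_one]
    · intro z B hB
      rw [LinearMap.mem_eqLocus] at *
      simp only [LinearMap.smul_apply, derAux_mul, derAux_inc, hB, map_smul, smul_add,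
        smul_mul_assoc, mul_smul_comm]

variable {V}

theorem der_inc (x y : V) : der K V x (ι y) = ι (gr x y) := derAux_inc K x y

theorem der_one (x : V) : der K V x 1 = 0 := derAux_one K x

theorem der_mul (x : V) (A B : U) : der K V x (A * B) = der K V x A * B + A * der K V x B :=
  derAux_mul K x A B

theorem der_comm (x y : V) :
    der K V (gr x y - gr y x + ⁅x, y⁆) = der K V x * der K V y - der K V y * der K V x := by
  ext A
  refine env_induction K (LinearMap.eqLocus (der K V (gr x y - gr y x + ⁅x, y⁆))
    (der K V x * der K V y - der K V y * der K V x)) ?_ ?_ A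
  · simp [der_one]
  · intro z B hB
    rw [LinearMap.mem_eqLocus] at *
    have e : gr (gr x y - gr y x + ⁅x, y⁆) z = gr x (gr y z) - gr y (gr x z) := by
      simp only [map_add, map_sub, LinearMap.add_apply, LinearMap.sub_apply,
        PostLieAlgebra.lie_graft]
      abel
    rw [der_mul, hB, der_inc, e]
    simp only [der_mul, der_inc, LinearMap.sub_apply, Module.End.mul_apply, map_add, map_sub,
      sub_mul, mul_sub]
    abel

variable (V)

/-- The action of `U(𝔤̃)` on `U(𝔤)` in which `x ∈ 𝔤̃` acts by the derivation `der x`. -/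
noncomputable def act :
    U₂ →ₐ[K]
      Module.End K (U) :=
  envLift₂ K (der K V) (der_comm K)

variable {V}

/-- An action of `U(𝔤̃)` on pairs, from which the maps `der₂ z` below are read off. -/
noncomputable def pairAux (y : V) : Module.End K (U₂ × (V →ₗ[K] U₂)) :=
  LinearMap.prod (LinearMap.mulLeft K (ι₂ y) ∘ₗ LinearMap.fst K _ _)
    (((LinearMap.mul K U₂).comp (ι₂ ∘ₗ (gr).flip y)).flip ∘ₗ LinearMap.fst K _ _ +
      (LinearMap.llcomp K V U₂ U₂ (LinearMap.mulLeft K (ι₂ y)) +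
        LinearMap.lcomp K U₂ (-(LieModule.toEnd K V V y : V →ₗ[K] V) - gr y)) ∘ₗ
          LinearMap.snd K _ _)

theorem pairAux_fst (y : V) (p) : (pairAux K y p).1 = ι₂ y * p.1 := rfl

theorem pairAux_snd (y : V) (p) (z : V) : (pairAux K y p).2 z =
    ι₂ (gr z y) * p.1 + ι₂ y * p.2 z + p.2 (⁅z, y⁆ - gr y z) := by
  simp [pairAux, add_assoc]

variable (V)

/-- The action of `y ∈ 𝔤̃` on pairs, as a linear map. -/
noncomputable def pair :
    V →ₗ[K] Module.End K (U₂ ×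
      (V →ₗ[K] U₂)) where
  toFun := pairAux K
  map_add' x y := by
    refine LinearMap.ext fun p => Prod.ext ?_ (LinearMap.ext fun z => ?_)
    · simp [pairAux_fst, add_mul]
    · simp only [pairAux_snd, LinearMap.add_apply, Prod.snd_add, map_add, lie_add, add_mul, map_sub]
      abel
  map_smul' t x := by
    refine LinearMap.ext fun p => Prod.ext ?_ (LinearMap.ext fun z => ?_)
    · simp [pairAux_fst]
    · simp [pairAux_snd, smul_add, smul_sub]

variable {V}

theorem pair_fst (y : V) (p) : (pair K V y p).1 = ι₂ y * p.1 := rfl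

theorem pair_snd (y : V) (p) (z : V) : (pair K V y p).2 z =
    ι₂ (gr z y) * p.1 + ι₂ y * p.2 z + p.2 (⁅z, y⁆ - gr y z) := pairAux_snd K y p z

theorem pair_comm (x y : V) :
    pair K V (gr x y - gr y x + ⁅x, y⁆) = pair K V x * pair K V y - pair K V y * pair K V x := by
  refine LinearMap.ext fun p => Prod.ext ?_ (LinearMap.ext fun z => ?_)
  · simp only [pair_fst, LinearMap.sub_apply, Module.End.mul_apply, Prod.fst_sub, ← mul_assoc,
      ← sub_mul, inc₂_comm]
  · have h1 := inc₂_comm K (gr z x) y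
    have h2 := inc₂_comm K x (gr z y)
    have h3 := inc₂_comm K x y
    have e1 : gr z (gr x y - gr y x + ⁅x, y⁆) =
        (gr (gr z x) y - gr y (gr z x) + ⁅gr z x, y⁆)
        + (gr x (gr z y) - gr (gr z y) x + ⁅x, gr z y⁆)
        + gr (⁅z, x⁆ - gr x z) y - gr (⁅z, y⁆ - gr y z) x := by
      simp only [map_add, map_sub, LinearMap.add_apply, LinearMap.sub_apply,
        PostLieAlgebra.lie_graft, PostLieAlgebra.graft_lie]
      abel
    have e2 : ⁅z, gr x y - gr y x + ⁅x, y⁆⁆ - gr (gr x y - gr y x + ⁅x, y⁆) z =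
        (⁅⁅z, x⁆ - gr x z, y⁆ - gr y (⁅z, x⁆ - gr x z))
        - (⁅⁅z, y⁆ - gr y z, x⁆ - gr x (⁅z, y⁆ - gr y z)) := by
      simp only [map_add, map_sub, LinearMap.add_apply, LinearMap.sub_apply,
        PostLieAlgebra.lie_graft, PostLieAlgebra.graft_lie, lie_add, lie_sub, add_lie, sub_lie,
        leibniz_lie z x y]
      rw [← lie_skew x ⁅z, y⁆]
      abel
    simp only [pair_snd, LinearMap.sub_apply, Module.End.mul_apply, Prod.snd_sub, pair_fst]
    rw [e1, e2, ← h3]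
    simp only [map_add ι₂ _ _, map_sub ι₂ _ _] at h1 h2 ⊢
    rw [← h1, ← h2]
    simp only [map_sub, map_add, mul_add, mul_sub, add_mul, sub_mul, mul_assoc]
    abel

variable (V)

/-- The action of `U(𝔤̃)` on pairs. -/
noncomputable def pairAct : U₂ →ₐ[K]
      Module.End K (U₂ ×
      (V →ₗ[K] U₂)) :=
  envLift₂ K (A := Module.End K (U₂ ×
      (V →ₗ[K] U₂))) (pair K V) (pair_comm K)

variable {V}

variable (V)

/-- The map `der z`, transported to `U(𝔤̃)`. -/
noncomputable def der₂ :
    V →ₗ[K] Module.End K (U₂) :=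
  (LinearMap.snd K _ _ ∘ₗ LinearMap.applyₗ
    ((1, 0) : U₂ ×
      (V →ₗ[K] U₂)) ∘ₗ
    (pairAct K V).toLinearMap).flip

variable {V}

theorem der₂_one (z : V) : der₂ K V z 1 = 0 := by simp [der₂]

theorem pairAct_fst (C : U₂) : (pairAct K V C (1, 0)).1 = C := by
  refine env_induction₂ K (LinearMap.eqLocus (LinearMap.fst K _ _ ∘ₗ LinearMap.applyₗ
    ((1, 0) : U₂ × (V →ₗ[K] U₂)) ∘ₗ (pairAct K V).toLinearMap) LinearMap.id) ?_ ?_ C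
  · simp
  · intro x A hA
    rw [LinearMap.mem_eqLocus] at *
    simp only [LinearMap.comp_apply, LinearMap.applyₗ_apply_apply, AlgHom.toLinearMap_apply,
      LinearMap.fst_apply, LinearMap.id_apply, map_mul, Module.End.mul_apply] at hA ⊢
    rw [pairAct, envLift₂_inc, pair_fst]
    rw [pairAct] at hA
    rw [hA]

theorem der₂_mul (z y : V) (C : U₂) : der₂ K V z (ι₂ y * C) =
    ι₂ (gr z y) * C + ι₂ y * der₂ K V z C + der₂ K V (⁅z, y⁆ - gr y z) C := by
  have h := pair_snd K y (pairAct K V C (1, 0)) z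
  rw [pairAct_fst] at h
  have h2 : pairAct K V (ι₂ y * C) = pair K V y * pairAct K V C := by
    rw [map_mul, pairAct, envLift₂_inc]
  change (pairAct K V (ι₂ y * C) (1, 0)).2 z = _
  rw [h2]
  exact h

theorem der₂_comm (C : U₂) : ∀ x y : V,
    der₂ K V (gr x y - gr y x + ⁅x, y⁆) C = der₂ K V x (der₂ K V y C) - der₂ K V y (der₂ K V x C) := by
  let S : Submodule K U₂ := ⨅ x : V, ⨅ y : V, LinearMap.eqLocus
    (der₂ K V (gr x y - gr y x + ⁅x, y⁆)) (der₂ K V x ∘ₗ der₂ K V y - der₂ K V y ∘ₗ der₂ K V x)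
  have key : C ∈ S := by
    refine env_induction₂ K S ?_ ?_ C
    · simp [S, der₂_one]
    · intro w B hB
      simp only [S, Submodule.mem_iInf, LinearMap.mem_eqLocus, LinearMap.sub_apply,
        LinearMap.comp_apply] at hB ⊢
      intro x y
      have e : ⁅gr x y - gr y x + ⁅x, y⁆, w⁆ - gr w (gr x y - gr y x + ⁅x, y⁆)
          = (⁅x, gr y w⁆ - gr (gr y w) x) - (⁅y, gr x w⁆ - gr (gr x w) y)
          + (gr (⁅x, w⁆ - gr w x) y - gr y (⁅x, w⁆ - gr w x) + ⁅⁅x, w⁆ - gr w x, y⁆)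
          + (gr x (⁅y, w⁆ - gr w y) - gr (⁅y, w⁆ - gr w y) x + ⁅x, ⁅y, w⁆ - gr w y⁆) := by
        simp only [map_add, map_sub, LinearMap.add_apply, LinearMap.sub_apply,
          PostLieAlgebra.lie_graft, PostLieAlgebra.graft_lie, lie_add, lie_sub, add_lie, sub_lie,
          leibniz_lie x y w]
        rw [← lie_skew y ⁅x, w⁆, ← lie_skew y (gr x w)]
        abel
      have e' : gr (gr x y - gr y x + ⁅x, y⁆) w = gr x (gr y w) - gr y (gr x w) := by
        simp only [map_add, map_sub, LinearMap.add_apply, LinearMap.sub_apply,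
          PostLieAlgebra.lie_graft]
        abel
      have H : ∀ a b c, der₂ K V (a + b + c) B = der₂ K V a B + der₂ K V b B + der₂ K V c B := by
        intro a b c; simp only [map_add, LinearMap.add_apply]
      rw [der₂_mul, e, e', H, hB (⁅x, w⁆ - gr w x) y, hB x (⁅y, w⁆ - gr w y), hB x y]
      simp only [der₂_mul, map_add, map_sub, LinearMap.add_apply, LinearMap.sub_apply, mul_add,
        mul_sub, add_mul, sub_mul]
      abel
  intro x y
  simp only [S, Submodule.mem_iInf, LinearMap.mem_eqLocus, LinearMap.sub_apply,
    LinearMap.comp_apply] at key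
  exact key x y

variable (V)

/-- The action of `U(𝔤)` on `U(𝔤̃)` in which `x ∈ 𝔤` acts by `C ↦ x C - der₂ x C`. -/
noncomputable def coAct : U →ₐ[K]
      Module.End K (U₂) :=
  envLift K (LinearMap.mul K _ ∘ₗ inc₂ K V - der₂ K V) (by
    intro x y
    ext C
    have h1 := inc₂_comm K x y
    have h2 := der₂_comm K C x y
    simp only [map_add, map_sub, LinearMap.add_apply, LinearMap.sub_apply] at h1 h2
    have h1' : inc₂ K V ⁅x, y⁆ = inc₂ K V x * inc₂ K V y - inc₂ K V y * inc₂ K V x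
      - inc₂ K V (gr x y) + inc₂ K V (gr y x) := by rw [h1]; abel
    have h2' : der₂ K V ⁅x, y⁆ C = der₂ K V x (der₂ K V y C) - der₂ K V y (der₂ K V x C)
      - der₂ K V (gr x y) C + der₂ K V (gr y x) C := by rw [← h2]; abel
    have h3 : der₂ K V ⁅y, x⁆ C = - der₂ K V ⁅x, y⁆ C := by
      rw [← lie_skew, map_neg, LinearMap.neg_apply]
    simp only [LinearMap.sub_apply, LinearMap.comp_apply, Module.End.mul_apply,
      LinearMap.mul_apply', map_sub, der₂_mul, h3, h2', h1', mul_sub, sub_mul, add_mul, mul_assoc]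
    abel)

variable {V}

variable (V)

/-- The linear map `U(𝔤) → U(𝔤̃)` with `1 ↦ 1` and `x A ↦ x Ψ(A) - Ψ(x ▷ A)`; it is an
isomorphism of coalgebras. -/
noncomputable def toU₂ : U →ₗ[K]
      U₂ :=
  LinearMap.applyₗ 1 ∘ₗ (coAct K V).toLinearMap

variable {V}

theorem toU₂_one : toU₂ K V 1 = 1 := by simp [toU₂]

theorem toU₂_mul (x : V) (A : U) :
    toU₂ K V (ι x * A) = ι₂ x * toU₂ K V A - der₂ K V x (toU₂ K V A) := by
  simp [toU₂, coAct, envLift_inc]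

theorem der₂_toU₂ (x : V) (A : U) : der₂ K V x (toU₂ K V A) = toU₂ K V (der K V x A) := by
  refine env_induction K
    (LinearMap.eqLocus (der₂ K V x ∘ₗ toU₂ K V) (toU₂ K V ∘ₗ der K V x)) ?_ ?_ A
  · simp [toU₂_one, der_one, der₂_one]
  · intro y B hB
    rw [LinearMap.mem_eqLocus] at *
    simp only [LinearMap.comp_apply] at *
    have h2 := der₂_comm K (toU₂ K V B) x y
    simp only [map_add, map_sub, LinearMap.add_apply, LinearMap.sub_apply] at h2
    have h2' : der₂ K V x (der₂ K V y (toU₂ K V B)) = der₂ K V ⁅x, y⁆ (toU₂ K V B)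
      + der₂ K V y (der₂ K V x (toU₂ K V B))
      + der₂ K V (gr x y) (toU₂ K V B) - der₂ K V (gr y x) (toU₂ K V B) := by
      rw [← sub_eq_iff_eq_add'.2 (sub_eq_iff_eq_add.1 h2.symm)]; abel
    simp only [toU₂_mul, der_mul, der_inc, map_add, map_sub, der₂_mul, LinearMap.sub_apply,
      LinearMap.add_apply, ← hB, h2']
    abel

variable (V)

/-- The Guin--Oudom extension `A ⊗ B ↦ A ▷ B` of the post-Lie product of `V` to `U(𝔤)`. The
construction goes through `U(𝔤̃)`, which acts on `U(𝔤)` by `act`; that the result satisfies the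
recursive equations defining the extension is `graftU_spec`. -/
noncomputable def graftU : U →ₗ[K]
      U →ₗ[K] U :=
  (act K V).toLinearMap ∘ₗ toU₂ K V

variable {V}

theorem graftU_one : graftU K V 1 = LinearMap.id := by
  simp [graftU, toU₂_one]; rfl

theorem graftU_inc_mul (x : V) (A B : U) : graftU K V (ι x * A) B =
    der K V x (graftU K V A B) - graftU K V (der K V x A) B := by
  simp [graftU, toU₂_mul, der₂_toU₂, act, envLift₂_inc]

theorem graftU_inc (x : V) (A : U) : graftU K V (ι x) A = der K V x A := by
  have := graftU_inc_mul K x 1 A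
  simpa [graftU_one, der_one] using this

end GuinOudom

section Products

variable (K V : Type*) [Field K] [LieRing V] [LieAlgebra K V] [PostLieAlgebra K V]

local notation "gr" => PostLieAlgebra.graft (K := K) (V := V)
local notation "U" => UniversalEnvelopingAlgebra K V
local notation "ι" => inc K V

variable {V}

theorem unshuffle_der (x : V) (A : U) : unshuffle K V (der K V x A) =
    (der K V x).rTensor U (unshuffle K V A) + (der K V x).lTensor U (unshuffle K V A) := by
  refine env_induction K (LinearMap.eqLocus ((unshuffle K V).toLinearMap ∘ₗ der K V x)
    (((der K V x).rTensor U + (der K V x).lTensor U) ∘ₗ (unshuffle K V).toLinearMap)) ?_ ?_ A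
  · rw [LinearMap.mem_eqLocus]
    simp [der_one, Algebra.TensorProduct.one_def]
  · intro y B hB
    rw [LinearMap.mem_eqLocus] at *
    simp only [LinearMap.comp_apply, AlgHom.toLinearMap_apply, LinearMap.add_apply] at hB ⊢
    simp only [der_mul, der_inc, map_add, map_mul, unshuffle_inc, hB]
    generalize unshuffle K V B = t
    induction t with
    | zero => simp
    | add a b ha hb =>
      have h := congrArg₂ (· + ·) ha hb
      simp only [mul_add, map_add] at h ⊢
      rw [← sub_eq_zero] at h ⊢
      rw [← h]; abel
    | tmul a b =>
      simp only [add_mul, Algebra.TensorProduct.tmul_mul_tmul, one_mul, LinearMap.rTensor_tmul,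
        LinearMap.lTensor_tmul, map_add, der_mul, der_inc, TensorProduct.add_tmul,
        TensorProduct.tmul_add, mul_add]
      abel

theorem der_mem_pow (x : V) (n : ℕ) : ∀ A ∈ (LinearMap.range ι) ^ n,
    der K V x A ∈ (LinearMap.range ι) ^ n := by
  induction n with
  | zero =>
    intro A hA
    rw [pow_zero, Submodule.mem_one] at hA
    obtain ⟨t, rfl⟩ := hA
    rw [Algebra.algebraMap_eq_smul_one, map_smul, der_one, smul_zero]
    exact zero_mem _
  | succ n ih =>
    intro A hA
    rw [pow_succ'] at hA ⊢
    induction hA using Submodule.mul_induction_on' with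
    | mem_mul_mem a ha b hb =>
      obtain ⟨y, rfl⟩ := ha
      rw [der_mul, der_inc]
      exact add_mem (Submodule.mul_mem_mul ⟨_, rfl⟩ hb) (Submodule.mul_mem_mul ⟨_, rfl⟩ (ih b hb))
    | add a _ b _ ha hb => rw [map_add]; exact add_mem ha hb

theorem mem_of_pow_le (P : Submodule K U) (h : ∀ n, (LinearMap.range ι) ^ n ≤ P) (A : U) :
    A ∈ P := by
  have : A ∈ ⨆ n, (LinearMap.range ι) ^ n := by
    refine env_induction K _ ?_ ?_ A
    · refine Submodule.mem_iSup_of_mem 0 ?_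
      rw [pow_zero]; exact Submodule.one_le.1 le_rfl
    · intro x A hA
      induction hA using Submodule.iSup_induction' with
      | mem n a ha =>
        refine Submodule.mem_iSup_of_mem (n + 1) ?_
        rw [pow_succ']
        exact Submodule.mul_mem_mul ⟨_, rfl⟩ ha
      | zero => simp
      | add a b _ _ ha hb => rw [mul_add]; exact add_mem ha hb
  exact iSup_le h this

theorem graftU_mul (A B C : U) : graftU K V A (B * C) =
    LinearMap.mul' K U (TensorProduct.map ((graftU K V).flip B) ((graftU K V).flip C)
      (unshuffle K V A)) := by
  let R : U →ₗ[K] U := LinearMap.mul' K U ∘ₗ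
    TensorProduct.map ((graftU K V).flip B) ((graftU K V).flip C) ∘ₗ (unshuffle K V).toLinearMap
  change A ∈ LinearMap.eqLocus ((graftU K V).flip (B * C)) R
  revert A
  refine mem_of_pow_le K _ ?_
  intro n
  induction n with
  | zero =>
    intro A hA
    rw [pow_zero, Submodule.mem_one] at hA
    obtain ⟨t, rfl⟩ := hA
    rw [Algebra.algebraMap_eq_smul_one]
    refine Submodule.smul_mem _ _ ?_
    simp [R, Algebra.TensorProduct.one_def, graftU_one]
  | succ n ih =>
    intro A hA
    rw [pow_succ'] at hA
    induction hA using Submodule.mul_induction_on' with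
    | add a _ b _ ha hb => exact add_mem ha hb
    | mem_mul_mem a ha b hb =>
      obtain ⟨y, rfl⟩ := ha
      have h1 : graftU K V b (B * C) = R b := ih hb
      have h2 : graftU K V (der K V y b) (B * C) = R (der K V y b) := ih (der_mem_pow K y n b hb)
      rw [LinearMap.mem_eqLocus, LinearMap.flip_apply, graftU_inc_mul, h1, h2]
      simp only [R, LinearMap.comp_apply, AlgHom.toLinearMap_apply, unshuffle_der, map_mul,
        unshuffle_inc]
      generalize unshuffle K V b = t
      induction t with
      | zero => simp
      | add a b ha hb =>
        have h := congrArg₂ (· + ·) ha hb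
        simp only [mul_add, map_add] at h ⊢
        rw [← sub_eq_zero] at h ⊢
        rw [← h]; abel
      | tmul a b =>
        simp only [add_mul, Algebra.TensorProduct.tmul_mul_tmul, one_mul, LinearMap.rTensor_tmul,
          LinearMap.lTensor_tmul, map_add, TensorProduct.map_tmul, LinearMap.mul'_apply,
          LinearMap.flip_apply, graftU_inc_mul, der_mul, sub_mul, mul_sub]
        abel

/-- `graftU` satisfies the defining equations of the Guin--Oudom extension: it extends the
post-Lie product, `1 ▷ A = A`, `xA ▷ y = x ▷ (A ▷ y) - (x ▷ A) ▷ y`, and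
`A ▷ BC = (A₍₁₎ ▷ B)(A₍₂₎ ▷ C)`. -/
theorem graftU_spec :
    (∀ x y : V, graftU K V (ι x) (ι y) = ι (gr x y)) ∧
    (∀ A : U, graftU K V 1 A = A) ∧
    (∀ (x y : V) (A : U), graftU K V (ι x * A) (ι y) =
      graftU K V (ι x) (graftU K V A (ι y)) - graftU K V (graftU K V (ι x) A) (ι y)) ∧
    (∀ A B C : U, graftU K V A (B * C) = LinearMap.mul' K U
      (TensorProduct.map ((graftU K V).flip B) ((graftU K V).flip C) (unshuffle K V A))) := by
  refine ⟨fun x y => ?_, fun A => ?_, fun x y A => ?_, graftU_mul K⟩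
  · rw [graftU_inc, der_inc]
  · rw [graftU_one, LinearMap.id_apply]
  · rw [graftU_inc_mul, graftU_inc, graftU_inc]

variable (V)

/-- The product `A ∗ B = A₍₁₎ · (A₍₂₎ ▷ B)` on `U(𝔤)`. -/
noncomputable def glProd : U →ₗ[K] U →ₗ[K] U :=
  LinearMap.mk₂ K
    (fun A B => LinearMap.mul' K U (((graftU K V).flip B).lTensor U (unshuffle K V A)))
    (fun A A' B => by rw [map_add, map_add, map_add])
    (fun t A B => by rw [map_smul, map_smul, map_smul])
    (fun A B B' => by rw [map_add, LinearMap.lTensor_add, LinearMap.add_apply, map_add])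
    (fun t A B => by rw [map_smul, LinearMap.lTensor_smul, LinearMap.smul_apply, map_smul])

end Products

section Grading

variable {K V Γ : Type*} [Field K] [LieRing V] [LieAlgebra K V]
  [AddCommMonoid Γ]

local notation "U" => UniversalEnvelopingAlgebra K V
local notation "ι" => inc K V

/-- A locally finite, connected grading of a post-Lie algebra: `V = ⨁ V_γ` with `V_0 = 0` and all
`V_γ` finite-dimensional, such that the bracket and the post-Lie product are homogeneous.
The degrees form a cancellative canonically ordered monoid in which every element has finitely
many lower bounds; the typical cases are `ℕ` and, for a set `C` of decorations, `C →₀ ℕ`. -/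
class PostLieGrading [PostLieAlgebra K V] (𝒱 : Γ → Submodule K V) : Prop where
  independent : iSupIndep 𝒱
  iSup_eq_top : ⨆ γ, 𝒱 γ = ⊤
  zero_eq_bot : 𝒱 0 = ⊥
  finite : ∀ γ, Module.Finite K (𝒱 γ)
  lie_mem : ∀ {i j : Γ} {x y : V}, x ∈ 𝒱 i → y ∈ 𝒱 j → ⁅x, y⁆ ∈ 𝒱 (i + j)
  graft_mem : ∀ {i j : Γ} {x y : V}, x ∈ 𝒱 i → y ∈ 𝒱 j →
    PostLieAlgebra.graft (K := K) x y ∈ 𝒱 (i + j)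

/-- The induced grading of `U(𝔤)`: `U(𝔤)_γ` is spanned by the products of homogeneous elements
of `𝔤` whose degrees add up to `γ`. -/
def envGrading (𝒱 : Γ → Submodule K V) (γ : Γ) : Submodule K U :=
  Submodule.span K {A | ∃ l : List (Γ × V), (∀ p ∈ l, p.2 ∈ 𝒱 p.1) ∧
    (l.map Prod.fst).sum = γ ∧ (l.map fun p => ι p.2).prod = A}

variable (𝒱 : Γ → Submodule K V)

/-- As `envGrading`, with a fixed number `n` of factors. -/
def wordGrading (n : ℕ) (γ : Γ) : Submodule K U :=
  Submodule.span K {A | ∃ l : List (Γ × V), (∀ p ∈ l, p.2 ∈ 𝒱 p.1) ∧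
    (l.map Prod.fst).sum = γ ∧ (l.map fun p => ι p.2).prod = A ∧ l.length = n}

theorem wordGrading_le (n : ℕ) (γ : Γ) : wordGrading 𝒱 n γ ≤ envGrading 𝒱 γ :=
  Submodule.span_mono fun _ ⟨l, h1, h2, h3, _⟩ => ⟨l, h1, h2, h3⟩

theorem one_mem_envGrading : (1 : U) ∈ envGrading 𝒱 0 :=
  Submodule.subset_span ⟨[], by simp, by simp, by simp⟩

variable {𝒱}

theorem mul_mem_envGrading {i j : Γ} {A B : U} (hA : A ∈ envGrading 𝒱 i)
    (hB : B ∈ envGrading 𝒱 j) : A * B ∈ envGrading 𝒱 (i + j) := by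
  have : envGrading 𝒱 i * envGrading 𝒱 j ≤ envGrading 𝒱 (i + j) := by
    rw [envGrading, envGrading, Submodule.span_mul_span, Submodule.span_le]
    rintro _ ⟨_, ⟨l, h1, rfl, rfl⟩, _, ⟨l', h1', rfl, rfl⟩, rfl⟩
    refine Submodule.subset_span ⟨l ++ l', ?_, by simp, by simp⟩
    intro p hp
    rcases List.mem_append.1 hp with h | h
    · exact h1 p h
    · exact h1' p h
  exact this (Submodule.mul_mem_mul hA hB)

theorem inc_mem_envGrading {i : Γ} {x : V} (hx : x ∈ 𝒱 i) : ι x ∈ envGrading 𝒱 i :=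
  Submodule.subset_span ⟨[(i, x)], by simpa using hx, by simp, by simp⟩

theorem cons_mem_wordGrading {n : ℕ} {i γ : Γ} {x : V} {A : U} (hx : x ∈ 𝒱 i)
    (hA : A ∈ wordGrading 𝒱 n γ) : ι x * A ∈ wordGrading 𝒱 (n + 1) (i + γ) := by
  induction hA using Submodule.span_induction with
  | mem A hA =>
    obtain ⟨l, h1, rfl, rfl, rfl⟩ := hA
    refine Submodule.subset_span ⟨(i, x) :: l, ?_, by simp, by simp, by simp⟩
    intro p hp
    rcases List.mem_cons.1 hp with rfl | h
    · exact hx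
    · exact h1 p h
  | zero => rw [mul_zero]; exact zero_mem _
  | add a b _ _ ha hb => rw [mul_add]; exact add_mem ha hb
  | smul t a _ ha => rw [mul_smul_comm]; exact Submodule.smul_mem _ _ ha

theorem unshuffle_mem {γ : Γ} {A : U} (hA : A ∈ envGrading 𝒱 γ) :
    unshuffle K V A ∈ Submodule.span K {t | ∃ i j : Γ, i + j = γ ∧ ∃ B ∈ envGrading 𝒱 i,
      ∃ C ∈ envGrading 𝒱 j, B ⊗ₜ[K] C = t} := by
  induction hA using Submodule.span_induction with
  | mem A hA =>
    obtain ⟨l, h1, rfl, rfl⟩ := hA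
    induction l with
    | nil =>
      refine Submodule.subset_span ⟨0, 0, by simp, 1, one_mem_envGrading 𝒱, 1,
        one_mem_envGrading 𝒱, ?_⟩
      simp [Algebra.TensorProduct.one_def]
    | cons p l ih =>
      have ih := ih (fun q hq => h1 q (List.mem_cons_of_mem _ hq))
      have hp := inc_mem_envGrading (h1 p List.mem_cons_self)
      simp only [List.map_cons, List.prod_cons, List.sum_cons, map_mul, unshuffle_inc]
      generalize unshuffle K V (l.map fun p => ι p.2).prod = t at ih
      induction ih using Submodule.span_induction with
      | mem t ht =>
        obtain ⟨i, j, hij, B, hB, C, hC, rfl⟩ := ht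
        rw [add_mul, Algebra.TensorProduct.tmul_mul_tmul, Algebra.TensorProduct.tmul_mul_tmul,
          one_mul, one_mul]
        refine add_mem (Submodule.subset_span ⟨p.1 + i, j, by rw [add_assoc, hij], _,
          mul_mem_envGrading hp hB, _, hC, rfl⟩) (Submodule.subset_span ⟨i, p.1 + j,
          by rw [add_left_comm, hij], _, hB, _, mul_mem_envGrading hp hC, rfl⟩)
      | zero => rw [mul_zero]; exact zero_mem _
      | add a b _ _ ha hb => rw [mul_add]; exact add_mem ha hb
      | smul t a _ ha => rw [mul_smul_comm]; exact Submodule.smul_mem _ _ ha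
  | zero => rw [map_zero]; exact zero_mem _
  | add a b _ _ ha hb => rw [map_add]; exact add_mem ha hb
  | smul t a _ ha => rw [map_smul]; exact Submodule.smul_mem _ _ ha

variable [PostLieAlgebra K V] [PostLieGrading 𝒱]

theorem der_mem_wordGrading {n : ℕ} {i γ : Γ} {x : V} {A : U} (hx : x ∈ 𝒱 i)
    (hA : A ∈ wordGrading 𝒱 n γ) : der K V x A ∈ wordGrading 𝒱 n (i + γ) := by
  induction hA using Submodule.span_induction with
  | mem A hA =>
    obtain ⟨l, h1, rfl, rfl, rfl⟩ := hA
    induction l with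
    | nil => simp [der_one]
    | cons p l ih =>
      have h2 : ∀ q ∈ l, q.2 ∈ 𝒱 q.1 := fun q hq => h1 q (List.mem_cons_of_mem _ hq)
      have ih := ih h2
      have hp := h1 p List.mem_cons_self
      simp only [List.map_cons, List.prod_cons, List.sum_cons, der_mul, der_inc, List.length_cons]
      refine add_mem ?_ ?_
      · rw [← add_assoc]
        exact cons_mem_wordGrading (PostLieGrading.graft_mem hx hp)
          (Submodule.subset_span ⟨l, h2, rfl, rfl, rfl⟩)
      · rw [add_left_comm]
        exact cons_mem_wordGrading hp ih
  | zero => rw [map_zero]; exact zero_mem _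
  | add a b _ _ ha hb => rw [map_add]; exact add_mem ha hb
  | smul t a _ ha => rw [map_smul]; exact Submodule.smul_mem _ _ ha

theorem der_mem_envGrading {i γ : Γ} {x : V} {A : U} (hx : x ∈ 𝒱 i)
    (hA : A ∈ envGrading 𝒱 γ) : der K V x A ∈ envGrading 𝒱 (i + γ) := by
  induction hA using Submodule.span_induction with
  | mem A hA =>
    obtain ⟨l, h1, rfl, rfl⟩ := hA
    exact wordGrading_le 𝒱 l.length _
      (der_mem_wordGrading hx (Submodule.subset_span ⟨l, h1, rfl, rfl, rfl⟩))
  | zero => rw [map_zero]; exact zero_mem _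
  | add a b _ _ ha hb => rw [map_add]; exact add_mem ha hb
  | smul t a _ ha => rw [map_smul]; exact Submodule.smul_mem _ _ ha

theorem graftU_mem {i j : Γ} {A B : U} (hA : A ∈ envGrading 𝒱 i) (hB : B ∈ envGrading 𝒱 j) :
    graftU K V A B ∈ envGrading 𝒱 (i + j) := by
  have key : ∀ n i, ∀ A ∈ wordGrading 𝒱 n i, graftU K V A B ∈ envGrading 𝒱 (i + j) := by
    intro n
    induction n with
    | zero =>
      intro i A hA
      induction hA using Submodule.span_induction with
      | mem A hA =>
        obtain ⟨l, h1, rfl, rfl, h⟩ := hA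
        obtain rfl := List.length_eq_zero_iff.1 h
        simpa [graftU_one] using hB
      | zero => rw [map_zero]; exact zero_mem _
      | add a b _ _ ha hb => rw [map_add]; exact add_mem ha hb
      | smul t a _ ha => rw [map_smul]; exact Submodule.smul_mem _ _ ha
    | succ n ih =>
      intro i A hA
      induction hA using Submodule.span_induction with
      | mem A hA =>
        obtain ⟨l, h1, rfl, rfl, h⟩ := hA
        obtain ⟨p, l, rfl⟩ := List.exists_cons_of_length_eq_add_one h
        have h2 : ∀ q ∈ l, q.2 ∈ 𝒱 q.1 := fun q hq => h1 q (List.mem_cons_of_mem _ hq)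
        have hp := h1 p List.mem_cons_self
        have hl : (l.map fun p => ι p.2).prod ∈ wordGrading 𝒱 n (l.map Prod.fst).sum :=
          Submodule.subset_span ⟨l, h2, rfl, rfl, by simpa using h⟩
        simp only [List.map_cons, List.prod_cons, List.sum_cons, graftU_inc_mul]
        refine sub_mem ?_ (ih _ _ (der_mem_wordGrading hp hl))
        rw [add_assoc]
        exact der_mem_envGrading hp (ih _ _ hl)
      | zero => rw [map_zero]; exact zero_mem _
      | add a b _ _ ha hb => rw [map_add]; exact add_mem ha hb
      | smul t a _ ha => rw [map_smul]; exact Submodule.smul_mem _ _ ha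
  induction hA using Submodule.span_induction with
  | mem A hA =>
    obtain ⟨l, h1, rfl, rfl⟩ := hA
    exact key l.length _ _ (Submodule.subset_span ⟨l, h1, rfl, rfl, rfl⟩)
  | zero => rw [map_zero]; exact zero_mem _
  | add a b _ _ ha hb => rw [map_add]; exact add_mem ha hb
  | smul t a _ ha => rw [map_smul]; exact Submodule.smul_mem _ _ ha

theorem glProd_mem {i j : Γ} {A B : U} (hA : A ∈ envGrading 𝒱 i) (hB : B ∈ envGrading 𝒱 j) :
    glProd K V A B ∈ envGrading 𝒱 (i + j) := by
  rw [glProd, LinearMap.mk₂_apply]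
  have h := unshuffle_mem hA
  generalize unshuffle K V A = t at h
  induction h using Submodule.span_induction with
  | mem t ht =>
    obtain ⟨k, l, rfl, C, hC, D, hD, rfl⟩ := ht
    rw [LinearMap.lTensor_tmul, LinearMap.mul'_apply, add_assoc]
    exact mul_mem_envGrading hC (graftU_mem hD hB)
  | zero => rw [map_zero, map_zero]; exact zero_mem _
  | add a b _ _ ha hb => rw [map_add, map_add]; exact add_mem ha hb
  | smul t a _ ha => rw [map_smul, map_smul]; exact Submodule.smul_mem _ _ ha

end Grading

section Dual

variable {K V Γ : Type*} [Field K] [LieRing V] [LieAlgebra K V]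
  [AddCommMonoid Γ]

local notation "U" => UniversalEnvelopingAlgebra K V
local notation "ι" => inc K V

/-- The graded dual `⨁ (U(𝔤)_γ)*` of `U(𝔤)`, as the space of linear functionals that vanish on
all but finitely many of the `U(𝔤)_γ`. -/
def gradedDual (𝒱 : Γ → Submodule K V) : Submodule K (Module.Dual K U) where
  carrier := {f | {γ | ∃ A ∈ envGrading 𝒱 γ, f A ≠ 0}.Finite}
  zero_mem' := by simp
  add_mem' {f g} hf hg := by
    refine (Set.Finite.union hf hg).subset ?_
    rintro γ ⟨A, hA, h⟩
    by_cases h' : f A = 0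
    · exact Or.inr ⟨A, hA, by simpa [h'] using h⟩
    · exact Or.inl ⟨A, hA, h'⟩
  smul_mem' t f hf := by
    refine Set.Finite.subset hf ?_
    rintro γ ⟨A, hA, h⟩
    exact ⟨A, hA, fun h' => h (by simp [h'])⟩

/-- The graded dual of `U(𝔤) ⊗ U(𝔤)`, which is graded by the `U(𝔤)_i ⊗ U(𝔤)_j`. -/
def gradedDual₂ (𝒱 : Γ → Submodule K V) : Submodule K (Module.Dual K (U ⊗[K] U)) where
  carrier := {F | {p : Γ × Γ | ∃ A ∈ envGrading 𝒱 p.1, ∃ B ∈ envGrading 𝒱 p.2,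
    F (A ⊗ₜ B) ≠ 0}.Finite}
  zero_mem' := by simp
  add_mem' {f g} hf hg := by
    refine (Set.Finite.union hf hg).subset ?_
    rintro γ ⟨A, hA, B, hB, h⟩
    by_cases h' : f (A ⊗ₜ B) = 0
    · exact Or.inr ⟨A, hA, B, hB, by simpa [h'] using h⟩
    · exact Or.inl ⟨A, hA, B, hB, h'⟩
  smul_mem' t f hf := by
    refine Set.Finite.subset hf ?_
    rintro γ ⟨A, hA, B, hB, h⟩
    exact ⟨A, hA, B, hB, fun h' => h (by simp [h'])⟩

variable (𝒱 : Γ → Submodule K V)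

/-- The pairing `⟨A ⊗ B, f ⊗ g⟩ = f(A) g(B)`, as a map from the tensor square of the graded dual
of `U(𝔤)` to the functionals on `U(𝔤) ⊗ U(𝔤)`. -/
noncomputable def pairing :
    gradedDual 𝒱 ⊗[K] gradedDual 𝒱 →ₗ[K] Module.Dual K (U ⊗[K] U) :=
  TensorProduct.dualDistrib K U U ∘ₗ
    TensorProduct.map (gradedDual 𝒱).subtype (gradedDual 𝒱).subtype

theorem pairing_tmul (f g : gradedDual 𝒱) (A B : U) :
    pairing 𝒱 (f ⊗ₜ g) (A ⊗ₜ B) = f.1 A * g.1 B := rfl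

theorem pairing_injective : Function.Injective (pairing 𝒱) := by
  classical
  suffices key : ∀ t, pairing 𝒱 t = 0 → t = 0 by
    intro a b hab
    have h : a + (-1 : K) • b = 0 := key _ (by
      rw [map_add, map_smul, hab]
      exact LinearMap.ext fun s => by simp)
    calc a = a + ((-1 : K) • b + (1 : K) • b) := by
          rw [← add_smul, neg_add_cancel, zero_smul, add_zero]
      _ = b := by rw [← add_assoc, h, zero_add, one_smul]
  intro t ht
  let b := Module.Basis.ofVectorSpace K (gradedDual 𝒱)
  let e := TensorProduct.equivFinsuppOfBasisLeft (N := gradedDual 𝒱) b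
  obtain ⟨c, rfl⟩ := e.symm.surjective t
  have hc : c = 0 := by
    ext i B
    have h : ∑ j ∈ c.support, (c j).1 B • b j = 0 := by
      apply Subtype.ext
      ext A
      have := LinearMap.congr_fun ht (A ⊗ₜ B)
      simp only [e, TensorProduct.equivFinsuppOfBasisLeft_symm_apply, Finsupp.sum, map_sum,
        LinearMap.sum_apply, pairing_tmul, LinearMap.zero_apply] at this
      simpa [mul_comm] using this
    by_cases hi : i ∈ c.support
    · exact linearIndependent_iff'.1 b.linearIndependent _ _ h i hi
    · rw [Finsupp.notMem_support_iff.1 hi]; rfl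
  rw [hc, map_zero]

theorem pairing_mem (t) : pairing 𝒱 t ∈ gradedDual₂ 𝒱 := by
  induction t with
  | zero => rw [map_zero]; exact zero_mem _
  | add a b ha hb => rw [map_add]; exact add_mem ha hb
  | tmul f g =>
    refine (Set.Finite.prod f.2 g.2).subset ?_
    rintro ⟨i, j⟩ ⟨A, hA, B, hB, h⟩
    rw [pairing_tmul] at h
    exact ⟨⟨A, hA, left_ne_zero_of_mul h⟩, ⟨B, hB, right_ne_zero_of_mul h⟩⟩

theorem iSup_envGrading [PostLieAlgebra K V] [PostLieGrading 𝒱] : ⨆ γ, envGrading 𝒱 γ = ⊤ := by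
  rw [eq_top_iff]
  intro A _
  refine env_induction K _ (Submodule.mem_iSup_of_mem 0 (one_mem_envGrading 𝒱)) ?_ A
  intro x A hA
  have hx : x ∈ ⨆ γ, 𝒱 γ := by rw [PostLieGrading.iSup_eq_top]; trivial
  induction hx using Submodule.iSup_induction' with
  | zero => simp
  | add a b _ _ ha hb => rw [map_add, add_mul]; exact add_mem ha hb
  | mem i x hx =>
    induction hA using Submodule.iSup_induction' with
    | zero => simp
    | add a b _ _ ha hb => rw [mul_add]; exact add_mem ha hb
    | mem j A hA =>
      exact Submodule.mem_iSup_of_mem (i + j) (mul_mem_envGrading (inc_mem_envGrading hx) hA)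

theorem exists_gradingHom [PostLieAlgebra K V] [PostLieGrading 𝒱] :
    ∃ F : U →ₐ[K] AddMonoidAlgebra U Γ,
      ∀ γ, ∀ A ∈ envGrading 𝒱 γ, F A = AddMonoidAlgebra.single γ A := by
  classical
  have hint : DirectSum.IsInternal 𝒱 :=
    (DirectSum.isInternal_submodule_iff_iSupIndep_and_iSup_eq_top 𝒱).2
      ⟨PostLieGrading.independent, PostLieGrading.iSup_eq_top⟩
  let e := LinearEquiv.ofBijective (DirectSum.coeLinearMap 𝒱) hint
  let f : V →ₗ[K] AddMonoidAlgebra U Γ :=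
    DirectSum.toModule K Γ _ (fun γ => (AddMonoidAlgebra.lsingle γ : U →ₗ[K] _) ∘ₗ inc K V ∘ₗ
      (𝒱 γ).subtype) ∘ₗ e.symm.toLinearMap
  have hf : ∀ γ, ∀ x ∈ 𝒱 γ, f x = AddMonoidAlgebra.single γ (ι x) := by
    intro γ x hx
    have : e.symm x = DirectSum.lof K Γ (fun γ => 𝒱 γ) γ ⟨x, hx⟩ := by
      rw [LinearEquiv.symm_apply_eq]
      exact (DirectSum.coeLinearMap_lof 𝒱 γ ⟨x, hx⟩).symm
    simp only [f, LinearMap.comp_apply, LinearEquiv.coe_coe, this, DirectSum.toModule_lof]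
    rfl
  have hlie : ∀ x y, f ⁅x, y⁆ = f x * f y - f y * f x := by
    intro x y
    have hx : x ∈ ⨆ γ, 𝒱 γ := by rw [PostLieGrading.iSup_eq_top]; trivial
    have hy : y ∈ ⨆ γ, 𝒱 γ := by rw [PostLieGrading.iSup_eq_top]; trivial
    induction hx using Submodule.iSup_induction' with
    | zero => simp
    | add a b _ _ ha hb => rw [add_lie, map_add, map_add, ha, hb, add_mul, mul_add]; abel
    | mem i x hx =>
      induction hy using Submodule.iSup_induction' with
      | zero => simp
      | add a b _ _ ha hb => rw [lie_add, map_add, map_add, ha, hb, add_mul, mul_add]; abel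
      | mem j y hy =>
        rw [hf i x hx, hf j y hy, hf (i + j) _ (PostLieGrading.lie_mem hx hy),
          AddMonoidAlgebra.single_mul_single, AddMonoidAlgebra.single_mul_single, add_comm j i,
          inc_lie, AddMonoidAlgebra.single_sub]
  refine ⟨envLift K f hlie, ?_⟩
  intro γ A hA
  induction hA using Submodule.span_induction with
  | mem A hA =>
    obtain ⟨l, h1, rfl, rfl⟩ := hA
    induction l with
    | nil => simp [AddMonoidAlgebra.one_def]
    | cons p l ih =>
      have ih := ih (fun q hq => h1 q (List.mem_cons_of_mem _ hq))
      simp only [List.map_cons, List.prod_cons, List.sum_cons, map_mul, ih, envLift_inc,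
        hf _ _ (h1 p List.mem_cons_self), AddMonoidAlgebra.single_mul_single]
  | zero => simp
  | add a b _ _ ha hb => rw [map_add, ha, hb, AddMonoidAlgebra.single_add]
  | smul t a _ ha => rw [map_smul, ha, AddMonoidAlgebra.smul_single]

/-- The projections of `U(𝔤)` onto its homogeneous components. -/
theorem exists_proj [PostLieAlgebra K V] [PostLieGrading 𝒱] (γ : Γ) :
    ∃ p : U →ₗ[K] envGrading 𝒱 γ, (∀ A : envGrading 𝒱 γ, p A.1 = A) ∧
      ∀ δ, δ ≠ γ → ∀ A ∈ envGrading 𝒱 δ, p A = 0 := by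
  classical
  obtain ⟨F, hF⟩ := exists_gradingHom 𝒱
  let q : U →ₗ[K] U :=
    { toFun := fun A => (F A).coeff γ
      map_add' := fun A B => by simp
      map_smul' := fun t A => by simp }
  have hq : ∀ δ, ∀ A ∈ envGrading 𝒱 δ, q A = if δ = γ then A else 0 := by
    intro δ A hA
    change (F A).coeff γ = _
    rw [hF δ A hA]
    simp [Finsupp.single_apply]
  have hmem : ∀ A, q A ∈ envGrading 𝒱 γ := by
    intro A
    have hA : A ∈ ⨆ γ, envGrading 𝒱 γ := by rw [iSup_envGrading]; trivial
    induction hA using Submodule.iSup_induction' with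
    | zero => rw [map_zero]; exact zero_mem _
    | add a b _ _ ha hb => rw [map_add]; exact add_mem ha hb
    | mem i x hx =>
      rw [hq i x hx]
      split_ifs with h
      · exact h ▸ hx
      · exact zero_mem _
  refine ⟨q.codRestrict _ hmem, fun A => Subtype.ext ?_, fun δ hδ A hA => Subtype.ext ?_⟩
  · exact (hq γ A.1 A.2).trans (if_pos rfl)
  · exact (hq δ A hA).trans (if_neg hδ)

variable [PartialOrder Γ] [IsOrderedCancelAddMonoid Γ] [CanonicallyOrderedAdd Γ]
  [LocallyFiniteOrderBot Γ]

theorem finite_envGrading [PostLieAlgebra K V] [PostLieGrading 𝒱] (γ : Γ) :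
    Module.Finite K (envGrading 𝒱 γ) := by
  classical
  induction hn : (Finset.Iic γ).card using Nat.strong_induction_on generalizing γ with
  | h n ih' =>
    have ih : ∀ j, j < γ → Module.Finite K (envGrading 𝒱 j) := fun j hj =>
      ih' _ (hn ▸ Finset.card_lt_card (Finset.Iic_ssubset_Iic.2 hj)) j rfl
    let P : Submodule K U := Submodule.span K {1} ⊔
      ⨆ i ∈ Finset.Iic γ, ⨆ j ∈ (Finset.Iic γ).filter (· < γ), (𝒱 i).map (ι) * envGrading 𝒱 j
    have hfd : P.FG := by
      refine Submodule.FG.sup (Submodule.fg_span_singleton _) ?_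
      refine Submodule.fg_biSup _ _ fun i _ => Submodule.fg_biSup _ _ fun j hj => ?_
      refine Submodule.FG.mul (Submodule.FG.map _ ?_) ?_
      · exact Module.Finite.iff_fg.1 (PostLieGrading.finite i)
      · exact Module.Finite.iff_fg.1 (ih j (Finset.mem_filter.1 hj).2)
    have hle : envGrading 𝒱 γ ≤ P := by
      rw [envGrading, Submodule.span_le]
      rintro _ ⟨l, h1, h2, rfl⟩
      cases l with
      | nil =>
        refine Submodule.mem_sup_left (Submodule.mem_span_singleton.2 ⟨1, by simp⟩)
      | cons p l =>
        by_cases hp : p.1 = 0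
        · have h3 := h1 p List.mem_cons_self
          rw [hp, PostLieGrading.zero_eq_bot (𝒱 := 𝒱), Submodule.mem_bot] at h3
          simp [h3]
        · refine Submodule.mem_sup_right ?_
          simp only [List.map_cons, List.sum_cons] at h2
          have hi : p.1 ≤ γ := h2 ▸ le_self_add
          have hj : (l.map Prod.fst).sum < γ := by
            rw [← h2]
            exact lt_add_of_pos_left _ (pos_iff_ne_zero.2 hp)
          refine Submodule.mem_iSup_of_mem p.1 (Submodule.mem_iSup_of_mem (by simpa using hi) ?_)
          refine Submodule.mem_iSup_of_mem (l.map Prod.fst).sum (Submodule.mem_iSup_of_mem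
            (by simpa using ⟨hj.le, hj⟩) ?_)
          simp only [List.map_cons, List.prod_cons]
          exact Submodule.mul_mem_mul ⟨p.2, h1 p List.mem_cons_self, rfl⟩
            (Submodule.subset_span ⟨l, fun q hq => h1 q (List.mem_cons_of_mem _ hq), rfl, rfl⟩)
    have := Module.Finite.iff_fg.2 hfd
    exact Submodule.finiteDimensional_of_le hle

theorem pairing_range [PostLieAlgebra K V] [PostLieGrading 𝒱] (F : Module.Dual K (U ⊗[K] U))
    (hF : F ∈ gradedDual₂ 𝒱) : ∃ t, pairing 𝒱 t = F := by
  classical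
  choose p hp hp' using exists_proj 𝒱
  have := finite_envGrading 𝒱
  let q : ∀ i, Module.Dual K (envGrading 𝒱 i) →ₗ[K] gradedDual 𝒱 := fun i =>
    LinearMap.codRestrict _ (p i).dualMap (by
      intro f
      refine (Set.finite_singleton i).subset ?_
      rintro j ⟨A, hA, h⟩
      by_contra hj
      exact h (by simp [hp' i j hj A hA]))
  have hq : ∀ i j t A B, pairing 𝒱 (TensorProduct.map (q i) (q j) t) (A ⊗ₜ B) =
      TensorProduct.dualDistrib K _ _ t (p i A ⊗ₜ p j B) := by
    intro i j t A B
    induction t with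
    | zero => simp
    | add a b ha hb => simp only [map_add, LinearMap.add_apply, ha, hb]
    | tmul f g => rfl
  have hs : ∀ i j, ∃ t : Module.Dual K (envGrading 𝒱 i) ⊗[K] Module.Dual K (envGrading 𝒱 j),
      TensorProduct.dualDistrib K _ _ t =
        F ∘ₗ TensorProduct.map (envGrading 𝒱 i).subtype (envGrading 𝒱 j).subtype := by
    intro i j
    exact (TensorProduct.dualDistribEquiv K (envGrading 𝒱 i) (envGrading 𝒱 j)).surjective _
  choose s hs using hs
  have hfin : {p : Γ × Γ | ∃ A ∈ envGrading 𝒱 p.1, ∃ B ∈ envGrading 𝒱 p.2,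
    F (A ⊗ₜ B) ≠ 0}.Finite := hF
  refine ⟨∑ r ∈ hfin.toFinset, TensorProduct.map (q r.1) (q r.2) (s r.1 r.2), ?_⟩
  apply TensorProduct.ext'
  intro A B
  have hA : A ∈ ⨆ γ, envGrading 𝒱 γ := by rw [iSup_envGrading]; trivial
  have hB : B ∈ ⨆ γ, envGrading 𝒱 γ := by rw [iSup_envGrading]; trivial
  induction hA using Submodule.iSup_induction' with
  | zero => simp
  | add a b _ _ ha hb => rw [TensorProduct.add_tmul, map_add, map_add, ha, hb]
  | mem i A hA =>
    induction hB using Submodule.iSup_induction' with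
    | zero => simp
    | add a b _ _ ha hb => rw [TensorProduct.tmul_add, map_add, map_add, ha, hb]
    | mem j B hB =>
      rw [map_sum, LinearMap.sum_apply, Finset.sum_eq_single (i, j)]
      · rw [hq, hs]
        have h1 := hp i ⟨A, hA⟩
        have h2 := hp j ⟨B, hB⟩
        simp only at h1 h2
        rw [h1, h2]; rfl
      · rintro ⟨k, l⟩ _ hkl
        rw [hq]
        by_cases hk : i = k
        · have hl : j ≠ l := by rintro rfl; exact hkl (by rw [hk])
          rw [hp' l j hl B hB, TensorProduct.tmul_zero, map_zero]
        · rw [hp' k i hk A hA, TensorProduct.zero_tmul, map_zero]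
      · intro hn
        rw [hq, hs]
        have h1 := hp i ⟨A, hA⟩
        have h2 := hp j ⟨B, hB⟩
        simp only at h1 h2
        rw [h1, h2]
        by_contra h0
        exact hn (hfin.mem_toFinset.2 ⟨A, hA, B, hB, h0⟩)

/-- The canonical identification of the tensor square of the graded dual of `U(𝔤)` with the graded
dual of `U(𝔤) ⊗ U(𝔤)`. -/
noncomputable def tensorDualEquiv [PostLieAlgebra K V] [PostLieGrading 𝒱] :
    (gradedDual 𝒱 ⊗[K] gradedDual 𝒱) ≃ₗ[K] gradedDual₂ 𝒱 :=
  LinearEquiv.ofBijective ((pairing 𝒱).codRestrict (gradedDual₂ 𝒱) (pairing_mem 𝒱))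
    ⟨fun _ _ h => pairing_injective 𝒱 (congrArg Subtype.val h),
      fun F => (pairing_range 𝒱 F.1 F.2).imp fun _ ht => Subtype.ext ht⟩

/-- The transpose of a homogeneous bilinear product `β` on `U(𝔤)`: the linear map `t` on the graded
dual that is determined by `⟨A ⊗ B, t f⟩ = f (β A B)`. -/
noncomputable def transpose [PostLieAlgebra K V] [PostLieGrading 𝒱] (β : U →ₗ[K] U →ₗ[K] U)
    (hβ : ∀ {i j : Γ} {A B : U}, A ∈ envGrading 𝒱 i → B ∈ envGrading 𝒱 j →
      β A B ∈ envGrading 𝒱 (i + j)) :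
    gradedDual 𝒱 →ₗ[K] gradedDual 𝒱 ⊗[K] gradedDual 𝒱 :=
  (tensorDualEquiv 𝒱).symm.toLinearMap ∘ₗ
    LinearMap.codRestrict (gradedDual₂ 𝒱) ((TensorProduct.lift β).dualMap ∘ₗ (gradedDual 𝒱).subtype)
    (by
      intro f
      have hf : {γ | ∃ A ∈ envGrading 𝒱 γ, f.1 A ≠ 0}.Finite := f.2
      refine (hf.biUnion (t := fun γ => (Set.Iic γ) ×ˢ (Set.Iic γ)) fun γ _ =>
        (Set.finite_Iic γ).prod (Set.finite_Iic γ)).subset ?_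
      rintro ⟨i, j⟩ ⟨A, hA, B, hB, h⟩
      refine Set.mem_biUnion (x := i + j) ⟨β A B, hβ hA hB, h⟩ ⟨?_, ?_⟩
      · exact le_self_add
      · exact le_add_self)

theorem pairing_transpose [PostLieAlgebra K V] [PostLieGrading 𝒱] (β : U →ₗ[K] U →ₗ[K] U)
    (hβ : ∀ {i j : Γ} {A B : U}, A ∈ envGrading 𝒱 i → B ∈ envGrading 𝒱 j →
      β A B ∈ envGrading 𝒱 (i + j)) (f : gradedDual 𝒱) (A B : U) :
    pairing 𝒱 (transpose 𝒱 β hβ f) (A ⊗ₜ B) = f.1 (β A B) := by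
  have h : ∀ F, pairing 𝒱 ((tensorDualEquiv 𝒱).symm F) = F.1 := fun F =>
    congrArg Subtype.val ((tensorDualEquiv 𝒱).apply_symm_apply F)
  simp only [transpose, LinearMap.comp_apply, LinearEquiv.coe_coe, h]
  rfl

/-- The shuffle product on the graded dual: the transpose of the unshuffle coproduct,
`(f ⧢ g)(A) = f(A₍₁₎) g(A₍₂₎)`. -/
noncomputable def shuffle : gradedDual 𝒱 ⊗[K] gradedDual 𝒱 →ₗ[K] gradedDual 𝒱 :=
  LinearMap.codRestrict (gradedDual 𝒱) ((unshuffle K V).toLinearMap.dualMap ∘ₗ pairing 𝒱) (by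
    intro t
    have ht : {p : Γ × Γ | ∃ A ∈ envGrading 𝒱 p.1, ∃ B ∈ envGrading 𝒱 p.2,
      pairing 𝒱 t (A ⊗ₜ B) ≠ 0}.Finite := pairing_mem 𝒱 t
    refine (ht.image fun p => p.1 + p.2).subset ?_
    rintro γ ⟨A, hA, h⟩
    by_contra hγ
    apply h
    have h2 := unshuffle_mem hA
    change pairing 𝒱 t (unshuffle K V A) = 0
    generalize unshuffle K V A = s at h2
    induction h2 using Submodule.span_induction with
    | zero => rw [map_zero]
    | add a b _ _ ha hb => rw [map_add, ha, hb, add_zero]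
    | smul t a _ ha => rw [map_smul, ha, smul_zero]
    | mem s hs =>
      obtain ⟨i, j, hij, B, hB, C, hC, rfl⟩ := hs
      by_contra h0
      exact hγ ⟨(i, j), ⟨B, hB, C, hC, h0⟩, hij⟩)

variable [PostLieAlgebra K V] [PostLieGrading 𝒱]

/-- The coproduct dual to the product of `U(𝔤)`: `⟨A ⊗ B, Δ f⟩ = f (A · B)`. -/
noncomputable def coprodMul : gradedDual 𝒱 →ₗ[K] gradedDual 𝒱 ⊗[K] gradedDual 𝒱 :=
  transpose 𝒱 (LinearMap.mul K U) mul_mem_envGrading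

/-- The coproduct dual to the product `∗` of `U(𝔤)`: `⟨A ⊗ B, Δ f⟩ = f (A ∗ B)`. -/
noncomputable def coprodStar : gradedDual 𝒱 →ₗ[K] gradedDual 𝒱 ⊗[K] gradedDual 𝒱 :=
  transpose 𝒱 (glProd K V) glProd_mem

/-- The coaction dual to the product `▷` of `U(𝔤)`: `⟨A ⊗ B, ρ f⟩ = f (A ▷ B)`. Both Hopf algebras
concerned, dual to `(U(𝔤), ·)` and to `(U(𝔤), ∗)`, have the graded dual as underlying algebra. -/
noncomputable def coaction : gradedDual 𝒱 →ₗ[K] gradedDual 𝒱 ⊗[K] gradedDual 𝒱 :=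
  transpose 𝒱 (graftU K V) graftU_mem

/-- The map `(a ⊗ (b ⊗ c)) ⊗ d ↦ (a ⧢ b) ⊗ (c ⊗ d)`. -/
noncomputable def mulOneTwo :
    (gradedDual 𝒱 ⊗[K] (gradedDual 𝒱 ⊗[K] gradedDual 𝒱)) ⊗[K] gradedDual 𝒱 →ₗ[K]
      gradedDual 𝒱 ⊗[K] (gradedDual 𝒱 ⊗[K] gradedDual 𝒱) :=
  (TensorProduct.assoc K _ _ _).toLinearMap ∘ₗ
    ((shuffle 𝒱).rTensor _ ∘ₗ (TensorProduct.assoc K _ _ _).symm.toLinearMap).rTensor _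

end Dual
end PostLie

namespace PostLie

/-! ### The module law for the Grossman–Larson product -/

section Associativity

variable (K : Type*) {V : Type*} [Field K] [LieRing V] [LieAlgebra K V] [PostLieAlgebra K V]

local notation "U" => UniversalEnvelopingAlgebra K V
local notation "ι" => inc K V

/-! The three maps are transposes of trilinear operations on `U(𝔤)`, so they are compared through
their values on `A ⊗ B ⊗ C`. At `f` the first has the value `f(A ▷ (B ▷ C))` and the last has the
value `f((A ∗ B) ▷ C)`. In the middle one, `Δ_⊙` multiplies the first two arguments, `id ⊗ ρ_▷`
grafts, and the shuffle product splits `A` by the unshuffle coproduct. Its value is therefore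
`f((A₍₁₎ · (A₍₂₎ ▷ B)) ▷ C)`, which is again `f((A ∗ B) ▷ C)`, by the definition of `∗`.

Thus the second equality is the dual of the definition of `∗`, and the first is the dual of the
module law `A ▷ (B ▷ C) = (A ∗ B) ▷ C`. That law (`graftU_graftU`) is proved by induction on the
length of `A` as a word in `𝔤`, from the recursion of `▷` in its left argument and the matching
recursion of `∗` (`glProd_inc_mul`).

The comparison of values is legitimate because an element of the tensor cube of the graded dual is
determined by them (`tensor_cube_ext`): slicing off the first factor reduces this to the injectivity
of the pairing on the tensor square. The grading and its finiteness conditions serve to make the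
transposes take values in the algebraic tensor square of the graded dual. -/

theorem glProd_apply (A B : U) : glProd K V A B =
    LinearMap.mul' K U (((graftU K V).flip B).lTensor U (unshuffle K V A)) := rfl

theorem glProd_one (B : U) : glProd K V 1 B = B := by
  simp [glProd_apply, Algebra.TensorProduct.one_def, graftU_one]

/-- Since `x` is primitive, the coproduct of `xA` is `xA₍₁₎ ⊗ A₍₂₎ + A₍₁₎ ⊗ xA₍₂₎`. The first part
gives `x · (A ∗ B)`. In the second, `xA₍₂₎ ▷ B = x ▷ (A₍₂₎ ▷ B) - (x ▷ A₍₂₎) ▷ B`, and the Leibniz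
rule turns `A₍₁₎ · (x ▷ (A₍₂₎ ▷ B))` into `x ▷ (A ∗ B) - (x ▷ A₍₁₎)(A₍₂₎ ▷ B)`. The two negative
terms add up to `-(x ▷ A) ∗ B`, because `x ▷ -` is a coderivation (`unshuffle_der`). -/
theorem glProd_inc_mul (x : V) (A B : U) : glProd K V (ι x * A) B =
    ι x * glProd K V A B + der K V x (glProd K V A B) - glProd K V (der K V x A) B := by
  simp only [glProd_apply, unshuffle_der, map_mul, unshuffle_inc]
  -- Both sides are now linear in the coproduct of `A`, and the identity holds with any tensor in
  -- its place, so pure tensors suffice.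
  generalize unshuffle K V A = t
  induction t with
  | zero => simp
  | add a b ha hb =>
    simp only [mul_add, map_add, ha, hb]
    abel
  | tmul a b =>
    simp only [add_mul, Algebra.TensorProduct.tmul_mul_tmul, one_mul, LinearMap.rTensor_tmul,
      LinearMap.lTensor_tmul, map_add, LinearMap.mul'_apply, LinearMap.flip_apply,
      graftU_inc_mul, der_mul, mul_sub, mul_assoc]
    abel

/-- `U(𝔤)` is a module over `(U(𝔤), ∗)` by the extended post-Lie product. -/
theorem graftU_graftU (A B C : U) :
    graftU K V A (graftU K V B C) = graftU K V (glProd K V A B) C := by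
  let P : Submodule K U := LinearMap.eqLocus ((graftU K V).flip (graftU K V B C))
    ((graftU K V).flip C ∘ₗ (glProd K V).flip B)
  change A ∈ P
  -- The recursion for `yb` involves `y ▷ b` as well as `b`. Induction on the number of factors, for
  -- all products of that length at once, covers both, since `y ▷ -` preserves the length.
  refine mem_of_pow_le K P (fun n => ?_) A
  induction n with
  | zero =>
    intro A hA
    rw [pow_zero, Submodule.mem_one] at hA
    obtain ⟨t, rfl⟩ := hA
    rw [Algebra.algebraMap_eq_smul_one]
    refine Submodule.smul_mem _ _ ?_
    simp [P, glProd_one, graftU_one]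
  | succ n ih =>
    intro A hA
    rw [pow_succ'] at hA
    induction hA using Submodule.mul_induction_on' with
    | add a _ b _ ha hb => exact add_mem ha hb
    | mem_mul_mem a ha b hb =>
      obtain ⟨y, rfl⟩ := ha
      have h1 : graftU K V b (graftU K V B C) = graftU K V (glProd K V b B) C := ih hb
      have h2 : graftU K V (der K V y b) (graftU K V B C) =
        graftU K V (glProd K V (der K V y b) B) C := ih (der_mem_pow K y n b hb)
      change graftU K V (ι y * b) (graftU K V B C) = graftU K V (glProd K V (ι y * b) B) C
      -- With `E = b ∗ B`, the right side contains `(yE) ▷ C + (y ▷ E) ▷ C`. Expanding the first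
      -- term as `y ▷ (E ▷ C) - (y ▷ E) ▷ C` leaves exactly `y ▷ (E ▷ C)`, as on the left.
      rw [graftU_inc_mul, h1, h2, glProd_inc_mul, map_sub, map_add, LinearMap.sub_apply,
        LinearMap.add_apply, graftU_inc_mul]
      abel

end Associativity

/-! ### Separating tensors by evaluation -/

section Slice

variable {K V Γ : Type*} [Field K] [LieRing V] [LieAlgebra K V] [AddCommMonoid Γ]
  (𝒱 : Γ → Submodule K V)

local notation "U" => UniversalEnvelopingAlgebra K V

/-- Evaluation of the first tensor factor: `f ⊗ m ↦ f(A) m`. -/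
noncomputable def slice (M : Type*) [AddCommMonoid M] [Module K M] (A : U) :
    gradedDual 𝒱 ⊗[K] M →ₗ[K] M :=
  (TensorProduct.lid K M).toLinearMap ∘ₗ
    (LinearMap.applyₗ A ∘ₗ (gradedDual 𝒱).subtype).rTensor M

variable {M N : Type*} [AddCommMonoid M] [Module K M] [AddCommMonoid N] [Module K N]

theorem slice_tmul (A : U) (f : gradedDual 𝒱) (m : M) :
    slice 𝒱 M A (f ⊗ₜ m) = f.1 A • m := by
  simp [slice]

theorem slice_lTensor (A : U) (φ : M →ₗ[K] N) (t : gradedDual 𝒱 ⊗[K] M) :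
    slice 𝒱 N A (φ.lTensor _ t) = φ (slice 𝒱 M A t) := by
  induction t with
  | zero => simp
  | add a b ha hb => simp only [map_add, ha, hb]
  | tmul f m => simp only [LinearMap.lTensor_tmul, slice_tmul, map_smul]

theorem slice_coe_apply (A B : U) (t : gradedDual 𝒱 ⊗[K] gradedDual 𝒱) :
    (slice 𝒱 _ A t).1 B = pairing 𝒱 t (A ⊗ₜ B) := by
  induction t with
  | zero => simp
  | add a b ha hb =>
    rw [map_add, map_add, LinearMap.add_apply, ← ha, ← hb]; rfl
  | tmul f g => rw [slice_tmul, pairing_tmul]; rfl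

/-- Relative to a basis of `M`, a tensor is a finitely supported family of functionals, and slicing
at `A` evaluates every member of the family at `A`. A functional is determined by its values. -/
theorem eq_of_slice_eq [Module.Free K M] {s t : gradedDual 𝒱 ⊗[K] M}
    (h : ∀ A, slice 𝒱 M A s = slice 𝒱 M A t) : s = t := by
  classical
  let b := Module.Free.chooseBasis K M
  let e := TensorProduct.equivFinsuppOfBasisRight (M := gradedDual 𝒱) b
  have key : ∀ c A i, b.repr (slice 𝒱 M A (e.symm c)) i = (c i).1 A := by
    intro c A i
    induction c using Finsupp.induction_linear with
    | zero => simp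
    | add c d hc hd => simp only [map_add, Finsupp.add_apply, hc, hd]; rfl
    | single j f =>
      simp only [e, TensorProduct.equivFinsuppOfBasisRight_symm_apply]
      rw [Finsupp.sum_single_index (by simp), slice_tmul]
      by_cases hij : j = i
      · subst hij; simp
      · simp [hij]
  obtain ⟨c, rfl⟩ := e.symm.surjective s
  obtain ⟨d, rfl⟩ := e.symm.surjective t
  congr 1
  ext i A
  rw [← key, ← key, h]

/-- An element of the tensor cube of the graded dual is determined by its values on the
`A ⊗ (B ⊗ C)`. -/
theorem tensor_cube_ext {s t : gradedDual 𝒱 ⊗[K] (gradedDual 𝒱 ⊗[K] gradedDual 𝒱)}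
    (h : ∀ A B C, pairing 𝒱 (slice 𝒱 _ A s) (B ⊗ₜ C) = pairing 𝒱 (slice 𝒱 _ A t) (B ⊗ₜ C)) :
    s = t := by
  -- `eq_of_slice_eq` is to be used with `M` the tensor square, whose freeness comes from that of
  -- its factors.
  have h₁ : Module.Free K (gradedDual 𝒱) :=
    Module.Free.of_basis (Module.Basis.ofVectorSpace K (gradedDual 𝒱))
  have h₂ : Module.Free K (gradedDual 𝒱 ⊗[K] gradedDual 𝒱) :=
    Module.Free.tensor (S := K)
  refine eq_of_slice_eq 𝒱 fun A => ?_
  exact pairing_injective 𝒱 (TensorProduct.ext' fun B C => h A B C)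

/-- Evaluates tensors bracketed to the left. Here `t` need not be pure, so it can be a coproduct or
the result of a shuffle. -/
theorem pairing_slice_assoc (A B C : U) (t : gradedDual 𝒱 ⊗[K] gradedDual 𝒱)
    (g : gradedDual 𝒱) :
    pairing 𝒱 (slice 𝒱 _ A (TensorProduct.assoc K _ _ _ (t ⊗ₜ g))) (B ⊗ₜ C) =
      pairing 𝒱 t (A ⊗ₜ B) * g.1 C := by
  induction t with
  | zero => simp
  | add a b ha hb => simp only [TensorProduct.add_tmul, map_add, LinearMap.add_apply, ha, hb,
      add_mul]
  | tmul a b =>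
    rw [TensorProduct.assoc_tmul, slice_tmul, map_smul, LinearMap.smul_apply, pairing_tmul,
      pairing_tmul, smul_eq_mul, mul_assoc]

theorem shuffle_coe_apply (t : gradedDual 𝒱 ⊗[K] gradedDual 𝒱) (A : U) :
    (shuffle 𝒱 t).1 A = pairing 𝒱 t (unshuffle K V A) := rfl

/-! ### Values of the dual maps on tensors -/

variable [PostLieAlgebra K V] [PartialOrder Γ] [IsOrderedCancelAddMonoid Γ]
  [CanonicallyOrderedAdd Γ] [LocallyFiniteOrderBot Γ] [PostLieGrading 𝒱]

theorem pairing_coaction (f : gradedDual 𝒱) (A B : U) :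
    pairing 𝒱 (coaction 𝒱 f) (A ⊗ₜ B) = f.1 (graftU K V A B) :=
  pairing_transpose 𝒱 _ _ f A B

theorem pairing_coprodStar (f : gradedDual 𝒱) (A B : U) :
    pairing 𝒱 (coprodStar 𝒱 f) (A ⊗ₜ B) = f.1 (glProd K V A B) :=
  pairing_transpose 𝒱 _ _ f A B

/-- An arbitrary `X` is allowed because the one needed later, `A₍₁₎ ⊗ (A₍₂₎ ▷ B)`, is a sum of pure
tensors. -/
theorem pairing_coprodMul (f : gradedDual 𝒱) (X : U ⊗[K] U) :
    pairing 𝒱 (coprodMul 𝒱 f) X = f.1 (LinearMap.mul' K U X) := by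
  induction X with
  | zero => simp
  | add a b ha hb => rw [map_add, map_add, map_add, ha, hb]
  | tmul A B => exact pairing_transpose 𝒱 _ _ f A B

/-- For `u = a ⊗ b`, the shuffle product distributes `A` as `A₍₁₎ ⊗ A₍₂₎` over `a` and the first leg
of `ρ_▷(b)`, while the second leg receives `B`. The value is `a(A₍₁₎) b(A₍₂₎ ▷ B)`. Taking `u =
Δ_⊙(f)` makes it `f(A ∗ B)`. -/
theorem pairing_shuffle_coaction (u : gradedDual 𝒱 ⊗[K] gradedDual 𝒱) (A B : U) :
    pairing 𝒱 ((shuffle 𝒱).rTensor _ ((TensorProduct.assoc K _ _ _).symm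
      ((coaction 𝒱).lTensor _ u))) (A ⊗ₜ B) =
      pairing 𝒱 u (((graftU K V).flip B).lTensor U (unshuffle K V A)) := by
  induction u with
  | zero => simp
  | add a b ha hb => simp only [map_add, LinearMap.add_apply, ha, hb]
  | tmul a b =>
    -- The coaction of `b` is in general not a pure tensor. It is replaced by an arbitrary `s`, in
    -- which both sides are linear, so that only `s = c ⊗ d` has to be computed.
    have h1 : ∀ (s : gradedDual 𝒱 ⊗[K] gradedDual 𝒱),
        pairing 𝒱 ((shuffle 𝒱).rTensor _ ((TensorProduct.assoc K _ _ _).symm (a ⊗ₜ s)))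
          (A ⊗ₜ B) = LinearMap.mul' K K (TensorProduct.map a.1
            (pairing 𝒱 s ∘ₗ (TensorProduct.mk K U U).flip B) (unshuffle K V A)) := by
      intro s
      induction s with
      | zero => simp
      | add s t hs ht =>
        simp only [TensorProduct.tmul_add, map_add, LinearMap.add_apply, LinearMap.add_comp,
          TensorProduct.map_add_right, hs, ht]
      | tmul c d =>
        rw [TensorProduct.assoc_symm_tmul, LinearMap.rTensor_tmul, pairing_tmul,
          shuffle_coe_apply]
        generalize unshuffle K V A = X
        induction X with
        | zero => simp
        | add X Y hX hY => simp only [map_add, add_mul, hX, hY]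
        | tmul D E => simp [pairing_tmul, mul_assoc]
    rw [LinearMap.lTensor_tmul, h1]
    generalize unshuffle K V A = X
    induction X with
    | zero => simp
    | add X Y hX hY => simp only [map_add, hX, hY]
    | tmul D E => simp [pairing_tmul, pairing_coaction]

theorem pairing_slice_lTensor_coaction (s : gradedDual 𝒱 ⊗[K] gradedDual 𝒱) (A B C : U) :
    pairing 𝒱 (slice 𝒱 _ A ((coaction 𝒱).lTensor _ s)) (B ⊗ₜ C) =
      pairing 𝒱 s (A ⊗ₜ graftU K V B C) := by
  rw [slice_lTensor, pairing_coaction, slice_coe_apply]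

theorem pairing_slice_rTensor_coprodStar (s : gradedDual 𝒱 ⊗[K] gradedDual 𝒱) (A B C : U) :
    pairing 𝒱 (slice 𝒱 _ A (TensorProduct.assoc K _ _ _ ((coprodStar 𝒱).rTensor _ s)))
      (B ⊗ₜ C) = pairing 𝒱 s (glProd K V A B ⊗ₜ C) := by
  induction s with
  | zero => simp
  | add a b ha hb => simp only [map_add, LinearMap.add_apply, ha, hb]
  | tmul f g => rw [LinearMap.rTensor_tmul, pairing_slice_assoc, pairing_coprodStar, pairing_tmul]

/-- On the first leg of `s`, the composite of `Δ_⊙`, the coaction and the shuffle product is `Δ_∗`: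
it is the transpose of `A ⊗ B ↦ A₍₁₎ · (A₍₂₎ ▷ B)`. The second leg is only evaluated at `C`. Hence
the agreement with `pairing_slice_rTensor_coprodStar` for every `s`, not just for those in the image
of the coaction. -/
theorem pairing_slice_mulOneTwo (s : gradedDual 𝒱 ⊗[K] gradedDual 𝒱) (A B C : U) :
    pairing 𝒱 (slice 𝒱 _ A (mulOneTwo 𝒱 (((coaction 𝒱).lTensor (gradedDual 𝒱)).rTensor _
      ((coprodMul 𝒱).rTensor _ s)))) (B ⊗ₜ C) = pairing 𝒱 s (glProd K V A B ⊗ₜ C) := by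
  induction s with
  | zero => simp
  | add a b ha hb => simp only [map_add, LinearMap.add_apply, ha, hb]
  | tmul f g =>
    simp only [mulOneTwo, LinearMap.comp_apply, LinearMap.rTensor_tmul, LinearEquiv.coe_coe]
    rw [pairing_slice_assoc, pairing_shuffle_coaction, pairing_coprodMul, pairing_tmul,
      glProd_apply]

end Slice

end PostLie

/-! ### Comparison of the three maps -/

theorem mainTheorem9 {K V Γ : Type*} [Field K] [LieRing V] [LieAlgebra K V] [PostLieAlgebra K V]
    [AddCommMonoid Γ] [PartialOrder Γ] [IsOrderedCancelAddMonoid Γ] [CanonicallyOrderedAdd Γ]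
    [LocallyFiniteOrderBot Γ] (𝒱 : Γ → Submodule K V) [PostLie.PostLieGrading 𝒱] :
    (PostLie.coaction 𝒱).lTensor (PostLie.gradedDual 𝒱) ∘ₗ PostLie.coaction 𝒱 =
        PostLie.mulOneTwo 𝒱 ∘ₗ
          ((PostLie.coaction 𝒱).lTensor (PostLie.gradedDual 𝒱)).rTensor (PostLie.gradedDual 𝒱) ∘ₗ
          (PostLie.coprodMul 𝒱).rTensor (PostLie.gradedDual 𝒱) ∘ₗ PostLie.coaction 𝒱 ∧
      PostLie.mulOneTwo 𝒱 ∘ₗ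
          ((PostLie.coaction 𝒱).lTensor (PostLie.gradedDual 𝒱)).rTensor (PostLie.gradedDual 𝒱) ∘ₗ
          (PostLie.coprodMul 𝒱).rTensor (PostLie.gradedDual 𝒱) ∘ₗ PostLie.coaction 𝒱 =
        (TensorProduct.assoc K (PostLie.gradedDual 𝒱) (PostLie.gradedDual 𝒱)
            (PostLie.gradedDual 𝒱)).toLinearMap ∘ₗ
          (PostLie.coprodStar 𝒱).rTensor (PostLie.gradedDual 𝒱) ∘ₗ PostLie.coaction 𝒱 := by
  refine ⟨LinearMap.ext fun f => PostLie.tensor_cube_ext 𝒱 fun A B C => ?_,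
    LinearMap.ext fun f => PostLie.tensor_cube_ext 𝒱 fun A B C => ?_⟩
  -- The values are `f(A ▷ (B ▷ C))` and `f((A ∗ B) ▷ C)`; the module law identifies them.
  · simp only [LinearMap.comp_apply]
    rw [PostLie.pairing_slice_lTensor_coaction, PostLie.pairing_slice_mulOneTwo,
      PostLie.pairing_coaction, PostLie.pairing_coaction, PostLie.graftU_graftU]
  -- No module law is needed here: both sides are the pairing of `ρ_▷(f)` with `(A ∗ B) ⊗ C`.
  · simp only [LinearMap.comp_apply, LinearEquiv.coe_coe]
    rw [PostLie.pairing_slice_rTensor_coprodStar, PostLie.pairing_slice_mulOneTwo]
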